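/- Let $\theta>0$, let $(\Omega,\mathcal A,\mathbb P)$ be a probability space carrying a space-time white noise $W$, i.e. a centered Gaussian field $(W(t,A))$ indexed by $t\ge 0$ and the bounded Borel sets $A\subset\mathbb R$, with $\mathbb E[W(t,A)W(s,B)]=(t\wedge s)\,\lambda(A\cap B)$, where $\lambda$ is the Lebesgue measure. Let $u_0$ be the mild solution of the linear stochastic heat equation $\partial_t u_0=\frac{\theta}{2}\Delta u_0+\dot W$ on $(0,\infty)\times\mathbb R$ with $u_0(0,\cdot)=0$, i.e. for all $t\ge0$, $x\in\mathbb R$, almost surely $$u_0(t,x)=\int_0^t\int_{\mathbb R}G(\theta(t-s),x-y)\,W(ds,dy),\qquad G(t,x)=\frac{1}{\sqrt{2\pi t}}\,e^{-x^2/(2t)}\quad(t>0),$$ where the integral is a Wiener integral. For $x\in\mathbb R$ and $N\ge1$ put $t_i=i/N$, $0\le i\le N$, and $$V_{N,x}(u_0)=\sum_{i=0}^{N-1}\bigl(u_0(t_{i+1},x)-u_0(t_i,x)\bigr)^4 .$$ Then, for every $x\in\mathbb R$, $$\lim_{N\to\infty}V_{N,x}(u_0)=\frac{6}{\pi\theta}\quad\text{almost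 surely and in }L^2(\mathbb P).$$ Moreover, there are a constant $C>0$ and an integer $N_0\ge1$, depending only on $\theta$, such that for all $x\in\mathbb R$ and all $N\ge N_0$, $$\mathbb E\left[\left|V_{N,x}(u_0)-\frac{6}{\pi\theta}\right|^2\right]\le \frac{C}{N}.$$ -/

import Mathlib

open MeasureTheory ProbabilityTheory Filter Topology
open scoped NNReal ENNReal

noncomputable section

namespace StochHeat

/-- The collection of bounded Borel subsets of `ℝ`. -/
abbrev BoundedBorel : Type :=
  {A : Set ℝ // MeasurableSet A ∧ Bornology.IsBounded A}

/-- `W` is a space-time white noise on `ℝ₊ × ℝ` under `P`: a centered Gaussian field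
`(W(t, A))` indexed by `t ≥ 0` and bounded Borel sets `A`, with covariance
`E[W(t, A) W(s, B)] = (t ∧ s) λ(A ∩ B)`, `λ` being the Lebesgue measure. -/
structure IsSpaceTimeWhiteNoise {Ω : Type*} [MeasurableSpace Ω]
    (W : ℝ≥0 → BoundedBorel → Ω → ℝ) (P : Measure Ω) : Prop where
  gaussian : IsGaussianProcess (fun p : ℝ≥0 × BoundedBorel => W p.1 p.2) P
  centered : ∀ (t : ℝ≥0) (A : BoundedBorel), ∫ ω, W t A ω ∂P = 0
  covariance : ∀ (t s : ℝ≥0) (A B : BoundedBorel),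
    ∫ ω, W t A ω * W s B ω ∂P = ((min t s : ℝ≥0) : ℝ) * volume.real (A.1 ∩ B.1)

/-- Lebesgue measure on `(0, ∞) × ℝ`, seen as a measure on `ℝ × ℝ`; points are `(s, y)`. -/
def spaceTime : Measure (ℝ × ℝ) :=
  volume.restrict (Set.Ioi (0 : ℝ) ×ˢ (Set.univ : Set ℝ))

/-- The elementary integrand `∑ₖ cₖ 1_{(0, tₖ] × Aₖ}`, encoded by the finitely supported
family `c` of its coefficients. -/
def elementaryFun (c : (ℝ≥0 × BoundedBorel) →₀ ℝ) (z : ℝ × ℝ) : ℝ :=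
  c.sum fun p a => a * (Set.Ioc (0 : ℝ) p.1 ×ˢ p.2.1).indicator (fun _ => (1 : ℝ)) z

/-- The Wiener integral `∑ₖ cₖ W(tₖ, Aₖ)` of the elementary integrand given by `c`. -/
def elementaryIntegral {Ω : Type*} (W : ℝ≥0 → BoundedBorel → Ω → ℝ)
    (c : (ℝ≥0 × BoundedBorel) →₀ ℝ) (ω : Ω) : ℝ :=
  c.sum fun p a => a * W p.1 p.2 ω

/-- `X` is (a version of) the Wiener integral `∫∫ f(s, y) W(ds, dy)` of the deterministic
square integrable function `f`: it is the `L²(P)`-limit of the integrals of elementary functions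
that converge to `f` in `L²((0, ∞) × ℝ)`. -/
def IsWienerIntegral {Ω : Type*} [MeasurableSpace Ω] (W : ℝ≥0 → BoundedBorel → Ω → ℝ)
    (P : Measure Ω) (f : ℝ × ℝ → ℝ) (X : Ω → ℝ) : Prop :=
  MemLp f 2 spaceTime ∧ MemLp X 2 P ∧
    ∃ c : ℕ → ((ℝ≥0 × BoundedBorel) →₀ ℝ),
      Tendsto (fun n => eLpNorm (fun z => elementaryFun (c n) z - f z) 2 spaceTime)
        atTop (𝓝 0) ∧
      Tendsto (fun n => eLpNorm (fun ω => elementaryIntegral W (c n) ω - X ω) 2 P)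
        atTop (𝓝 0)

/-- The Green kernel `G(t, x) = (2πt)^{-1/2} exp(-x²/(2t))` of the heat equation (for `t > 0`). -/
def heatKernel (t x : ℝ) : ℝ :=
  1 / √(2 * Real.pi * t) * Real.exp (-x ^ 2 / (2 * t))

/-- The integrand `(s, y) ↦ G(θ(t - s), x - y) 1_{(0, t)}(s)` of the mild formulation. -/
def mildIntegrand (θ : ℝ) (t : ℝ≥0) (x : ℝ) (z : ℝ × ℝ) : ℝ :=
  (Set.Ioo (0 : ℝ) t).indicator (fun s => heatKernel (θ * (t - s)) (x - z.2)) z.1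

/-- `u` is (a version of) the mild solution of the linear stochastic heat equation
`∂u/∂t = (θ/2) Δu + Ẇ` on `ℝ` with zero initial value, i.e. for all `t ≥ 0` and `x`,
`u(t, x) = ∫₀ᵗ ∫_ℝ G(θ(t - s), x - y) W(ds, dy)` almost surely. -/
def IsMildSolution {Ω : Type*} [MeasurableSpace Ω] (θ : ℝ) (W : ℝ≥0 → BoundedBorel → Ω → ℝ)
    (P : Measure Ω) (u : ℝ≥0 → ℝ → Ω → ℝ) : Prop :=
  ∀ (t : ℝ≥0) (x : ℝ), IsWienerIntegral W P (mildIntegrand θ t x) (u t x)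

/-- The quartic variation in time
`V_{N,x}(u) = ∑_{i=0}^{N-1} (u(t_{i+1}, x) - u(t_i, x))⁴`, with `t_i = i / N`. -/
def quarticVariation {Ω : Type*} (u : ℝ≥0 → ℝ → Ω → ℝ) (N : ℕ) (x : ℝ) (ω : Ω) : ℝ :=
  ∑ i ∈ Finset.range N,
    (u (((i + 1 : ℕ) : ℝ≥0) / (N : ℝ≥0)) x ω - u ((i : ℝ≥0) / (N : ℝ≥0)) x ω) ^ 4

end StochHeat

end

noncomputable section

namespace StochHeat

/-! For fixed x the increments over the N grid cells form a centered Gaussian vector with covariance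
`covConst θ / √N * incCov i j`. By the Wiener isometry and the semigroup property of the heat
kernel, E[u(t,x)u(s,x)] is a multiple of √(t+s) − √|t−s|, so `incCov` consists of second differences
of the square root. By concavity these all have one sign, and their sums telescope: the diagonal is
2 up to a summable error, and absolute row sums are at most 6, uniformly in N.

The diagonal determines the mean of the quartic variation, within O(1/N) of 12 `covConst θ` ² =
6/(πθ). The row sums control the fluctuations. With F(x) = ∑ xᵢ⁴ and Y an independent copy of X,
rotating (X, Y) by a quarter turn leaves the law invariant. Integrating the derivative along the
turn gives E(F(X) − F(Y))⁴ ≤ (π/2)⁴ E(∇F(X)·Y)⁴. Given X, ∇F(X)·Y is Gaussian with variance at most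
(maximal row sum)·|∇F(X)|². The bound `lintegral_quartic_le` scales as N² · (N^{-1/2})⁸ = N⁻².

A fourth moment of order N⁻² is summable, which gives almost sure convergence without comparing
different N; its square root gives the variance rate 1/N, hence the L² statements. -/

/-! ### Moments of centered Gaussian variables. -/

theorem memLp_pow_of_memLp_mul {α : Type*} [MeasurableSpace α] {μ : Measure α} {f : α → ℝ}
    {p : ℝ≥0∞} {n : ℕ} (hn : n ≠ 0) (hf : MemLp f (p * n) μ) :
    MemLp (fun x => f x ^ n) p μ := by
  have h := hf.norm_rpow_div (n : ℝ≥0∞)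
  have hp : p * n / (n : ℝ≥0∞) = p :=
    ENNReal.mul_div_cancel_right (by exact_mod_cast hn) (ENNReal.natCast_ne_top n)
  rw [hp] at h
  refine h.congr_norm (hf.1.pow n) (ae_of_all _ fun x => ?_)
  simp

theorem gaussianReal_eq_map_sqrt_mul (v : ℝ≥0) :
    gaussianReal 0 v = (gaussianReal 0 1).map (fun x => √(v : ℝ) * x) := by
  rw [gaussianReal_map_const_mul]
  congr 1
  · simp
  · ext; simp

theorem integral_pow_two_mul_gaussianReal (v : ℝ≥0) (k : ℕ) :
    ∫ x, x ^ (2 * k) ∂gaussianReal 0 v = (v : ℝ) ^ k * ∫ x, x ^ (2 * k) ∂gaussianReal 0 1 := by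
  rw [gaussianReal_eq_map_sqrt_mul v, integral_map (by fun_prop) (by fun_prop),
    ← integral_const_mul]
  congr 1; ext x
  rw [mul_pow, pow_mul, Real.sq_sqrt v.coe_nonneg]

theorem integral_pow_four_gaussianReal_one : ∫ x, x ^ 4 ∂gaussianReal 0 1 = 3 := by
  rw [integral_gaussianReal_eq_integral_smul (by norm_num)]
  simp only [gaussianPDFReal, smul_eq_mul, sub_zero, NNReal.coe_one, mul_one]
  have h1 : ∀ x : ℝ, (√(2 * Real.pi))⁻¹ * Real.exp (-x ^ 2 / 2) * x ^ 4
      = (√(2 * Real.pi))⁻¹ * (fun y : ℝ => y ^ (4 : ℝ) * Real.exp (-(1/2) * y ^ (2 : ℝ))) |x| := by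
    intro x
    have e2 : |x| ^ (2 : ℝ) = x ^ 2 := by
      rw [show (2 : ℝ) = ((2 : ℕ) : ℝ) by norm_num, Real.rpow_natCast, sq_abs]
    have e4 : |x| ^ (4 : ℝ) = x ^ 4 := by
      rw [show (4 : ℝ) = ((4 : ℕ) : ℝ) by norm_num, Real.rpow_natCast,
        (by decide : Even 4).pow_abs]
    simp only [e2, e4]
    rw [show -x ^ 2 / 2 = -(1/2) * x ^ 2 by ring]
    ring
  simp_rw [h1]
  -- Folding the even integrand onto (0, ∞) turns the moment into Γ(5/2).
  rw [integral_const_mul, integral_comp_abs (f := fun y : ℝ => y ^ (4 : ℝ) *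
      Real.exp (-(1/2) * y ^ (2 : ℝ))),
    integral_rpow_mul_exp_neg_mul_rpow (by norm_num) (by norm_num) (by norm_num)]
  rw [show ((4 : ℝ) + 1) / 2 = (2 : ℕ) + 1 / 2 by norm_num, Real.Gamma_nat_add_half]
  rw [show -((4 : ℝ) + 1) / 2 = -(2 : ℕ) - 1 / 2 by norm_num,
    Real.rpow_sub (by norm_num), Real.rpow_neg (by norm_num), Real.rpow_natCast,
    ← Real.sqrt_eq_rpow, Real.sqrt_div (by norm_num), Real.sqrt_mul (by norm_num)]
  have : √Real.pi ≠ 0 := by positivity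
  have h2 : √(2 : ℝ) * √2 = 2 := Real.mul_self_sqrt (by norm_num)
  have h3 : (√(2 : ℝ)) ≠ 0 := by positivity
  norm_num [Nat.doubleFactorial]
  field_simp

theorem integral_pow_four_gaussianReal (v : ℝ≥0) :
    ∫ x, x ^ 4 ∂gaussianReal 0 v = 3 * (v : ℝ) ^ 2 := by
  rw [integral_pow_two_mul_gaussianReal v 2, integral_pow_four_gaussianReal_one]; ring

/-! ### Centered Gaussian vectors. -/

/-- `μ` is a centered Gaussian measure on `ι → ℝ` with covariance matrix `S`. -/
structure IsCenteredGaussian {ι : Type*} [Fintype ι] (μ : Measure (ι → ℝ)) (S : ι → ι → ℝ) :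
    Prop where
  nonneg : ∀ a : ι → ℝ, 0 ≤ ∑ i, ∑ j, a i * a j * S i j
  map_eq : ∀ a : ι → ℝ, μ.map (fun x => ∑ i, a i * x i) =
    gaussianReal 0 (∑ i, ∑ j, a i * a j * S i j).toNNReal

namespace IsCenteredGaussian

variable {ι : Type*} [Fintype ι] {μ : Measure (ι → ℝ)} {S : ι → ι → ℝ}

theorem isGaussian (h : IsCenteredGaussian μ S) : IsGaussian μ := by
  classical
  refine isGaussian_of_map_eq_gaussianReal fun L => ⟨0,
    (∑ i, ∑ j, L (Pi.single i 1) * L (Pi.single j 1) * S i j).toNNReal, ?_⟩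
  · have : (⇑L : (ι → ℝ) → ℝ) = fun x => ∑ i, L (Pi.single i 1) * x i := by
      ext x
      conv_lhs => rw [← Finset.univ_sum_single x, map_sum]
      refine Finset.sum_congr rfl fun i _ => ?_
      rw [show Pi.single i (x i) = x i • (Pi.single i (1 : ℝ) : ι → ℝ) by
        rw [← Pi.single_smul]; simp, map_smul, smul_eq_mul, mul_comm]
    rw [← h.map_eq fun i => L (Pi.single i 1), ← this]

theorem map_eval (h : IsCenteredGaussian μ S) (i : ι) :
    μ.map (fun x => x i) = gaussianReal 0 (S i i).toNNReal := by
  classical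
  have := h.map_eq (Pi.single i 1)
  simpa [Pi.single_apply] using this

theorem diag_nonneg (h : IsCenteredGaussian μ S) (i : ι) : 0 ≤ S i i := by
  classical
  have := h.nonneg (Pi.single i 1)
  simpa [Pi.single_apply] using this

theorem integral_pow_eval (h : IsCenteredGaussian μ S) (i : ι) (k : ℕ) :
    ∫ x, x i ^ (2 * k) ∂μ = S i i ^ k * ∫ x, x ^ (2 * k) ∂gaussianReal 0 1 := by
  have := integral_map (μ := μ) (φ := fun x => x i) (measurable_pi_apply i).aemeasurable
    (f := fun y : ℝ => y ^ (2 * k)) (by fun_prop)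
  rw [← this, h.map_eval, integral_pow_two_mul_gaussianReal, Real.coe_toNNReal _ (h.diag_nonneg i)]

theorem integral_sum_mul_pow_four (h : IsCenteredGaussian μ S) (a : ι → ℝ) :
    ∫ x, (∑ i, a i * x i) ^ 4 ∂μ = 3 * (∑ i, ∑ j, a i * a j * S i j) ^ 2 := by
  have := integral_map (μ := μ) (φ := fun x => ∑ i, a i * x i)
    (by fun_prop : Measurable _).aemeasurable
    (f := fun y : ℝ => y ^ 4) (by fun_prop)
  rw [← this, h.map_eq, integral_pow_four_gaussianReal, Real.coe_toNNReal _ (h.nonneg a)]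

theorem memLp_linear (h : IsCenteredGaussian μ S) (a : ι → ℝ) {p : ℝ≥0∞} (hp : p ≠ ∞) :
    MemLp (fun x => ∑ i, a i * x i) p μ := by
  have := memLp_id_gaussianReal' (μ := 0) (v := (∑ i, ∑ j, a i * a j * S i j).toNNReal) p hp
  rw [← h.map_eq] at this
  exact this.comp_of_map (by fun_prop : Measurable _).aemeasurable

theorem memLp_eval (h : IsCenteredGaussian μ S) (i : ι) {p : ℝ≥0∞} (hp : p ≠ ∞) :
    MemLp (fun x => x i) p μ := by
  classical
  simpa [Pi.single_apply] using h.memLp_linear (Pi.single i 1) hp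

theorem memLp_eval_pow (h : IsCenteredGaussian μ S) (i : ι) {n : ℕ} (hn : n ≠ 0)
    {p : ℝ≥0∞} (hp : p ≠ ∞) : MemLp (fun x => x i ^ n) p μ :=
  memLp_pow_of_memLp_mul hn (h.memLp_eval i (ENNReal.mul_ne_top hp (ENNReal.natCast_ne_top n)))

theorem memLp_sum_pow_four (h : IsCenteredGaussian μ S) {p : ℝ≥0∞} (hp : p ≠ ∞) :
    MemLp (fun x : ι → ℝ => ∑ i, x i ^ 4) p μ :=
  memLp_finsetSum _ fun i _ => h.memLp_eval_pow i (by norm_num) hp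

theorem integral_sum_pow_four (h : IsCenteredGaussian μ S) :
    ∫ x, ∑ i, x i ^ 4 ∂μ = ∑ i, 3 * S i i ^ 2 := by
  have := h.isGaussian
  rw [integral_finsetSum]
  · refine Finset.sum_congr rfl fun i _ => ?_
    rw [h.integral_pow_eval i 2, integral_pow_four_gaussianReal_one, mul_comm]
  · exact fun i _ => (h.memLp_eval_pow i (by norm_num) ENNReal.one_ne_top).integrable le_rfl

/-- The joint law of two independent copies is rotation invariant because the common mean vanishes,
which is checked coordinate by coordinate. -/
theorem map_rotation (h : IsCenteredGaussian μ S) (φ : ℝ) :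
    (μ.prod μ).map (ContinuousLinearMap.rotation φ) = μ.prod μ := by
  have := h.isGaussian
  refine IsGaussian.map_rotation_eq_self ?_ φ
  ext i
  have h1 := ContinuousLinearMap.integral_comp_comm (ContinuousLinearMap.proj (R := ℝ)
    (φ := fun _ : ι => ℝ) i) (IsGaussian.integrable_id (μ := μ))
  have h2 : ∫ x, x i ∂μ = 0 := by
    have := integral_map (μ := μ) (φ := fun x => x i) (measurable_pi_apply i).aemeasurable
      (f := fun y : ℝ => y) (by fun_prop)
    rw [← this, h.map_eval, integral_id_gaussianReal]
  simpa [h2] using h1.symm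

end IsCenteredGaussian

/-! ### Fourth moment bound by Gaussian rotation. -/

/-- Schur's test: 2|wᵢwⱼ| ≤ wᵢ² + wⱼ², and symmetry of `S` makes the two resulting sums equal. -/
theorem quadraticForm_le_of_row_sum_le {ι : Type*} [Fintype ι] {S : ι → ι → ℝ}
    (hS : ∀ i j, S i j = S j i) {M : ℝ} (hM : ∀ i, ∑ j, |S i j| ≤ M) (w : ι → ℝ) :
    ∑ i, ∑ j, w i * w j * S i j ≤ M * ∑ i, w i ^ 2 := by
  have h1 : ∀ i j, w i * w j * S i j ≤ |S i j| * w i ^ 2 / 2 + |S i j| * w j ^ 2 / 2 := by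
    intro i j
    have h2 : w i * w j * S i j ≤ |w i * w j| * |S i j| := by
      rw [← abs_mul]; exact le_abs_self _
    have h3 : |w i * w j| ≤ (w i ^ 2 + w j ^ 2) / 2 := by
      rw [abs_le]; constructor <;> nlinarith [sq_nonneg (w i + w j), sq_nonneg (w i - w j)]
    nlinarith [mul_le_mul_of_nonneg_right h3 (abs_nonneg (S i j))]
  have h4 : ∑ i, ∑ j, |S i j| * w j ^ 2 / 2 = ∑ i, ∑ j, |S i j| * w i ^ 2 / 2 := by
    rw [Finset.sum_comm]
    exact Finset.sum_congr rfl fun i _ => Finset.sum_congr rfl fun j _ => by rw [hS]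
  calc ∑ i, ∑ j, w i * w j * S i j
      ≤ ∑ i, ∑ j, (|S i j| * w i ^ 2 / 2 + |S i j| * w j ^ 2 / 2) :=
        Finset.sum_le_sum fun i _ => Finset.sum_le_sum fun j _ => h1 i j
    _ = ∑ i, (∑ j, |S i j|) * w i ^ 2 := by
        simp_rw [Finset.sum_add_distrib]
        rw [h4, ← Finset.sum_add_distrib]
        refine Finset.sum_congr rfl fun i _ => ?_
        rw [← Finset.sum_add_distrib, Finset.sum_mul]
        exact Finset.sum_congr rfl fun j _ => by ring
    _ ≤ ∑ i, M * w i ^ 2 :=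
        Finset.sum_le_sum fun i _ => mul_le_mul_of_nonneg_right (hM i) (sq_nonneg _)
    _ = M * ∑ i, w i ^ 2 := by rw [Finset.mul_sum]

theorem integral_pow_four_le {α : Type*} [MeasurableSpace α] {μ : Measure α}
    [IsProbabilityMeasure μ] {f : α → ℝ} (hf : Integrable f μ)
    (hf4 : Integrable (fun x => f x ^ 4) μ) : (∫ x, f x ∂μ) ^ 4 ≤ ∫ x, f x ^ 4 ∂μ :=
  (Even.convexOn_pow (by decide : Even 4)).map_integral_le (by fun_prop) isClosed_univ
    (ae_of_all _ fun _ => Set.mem_univ _) hf hf4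

/-- The derivative of `x ↦ ∑ i, x i ^ 4` at `p.1` in the direction `p.2`. -/
def quarticDeriv {ι : Type*} [Fintype ι] (p : (ι → ℝ) × (ι → ℝ)) : ℝ :=
  ∑ i, 4 * p.1 i ^ 3 * p.2 i

theorem continuous_quarticDeriv {ι : Type*} [Fintype ι] :
    Continuous (quarticDeriv (ι := ι)) := by
  unfold quarticDeriv; fun_prop

theorem continuous_rotation {ι : Type*} [Fintype ι] :
    Continuous fun q : ℝ × ((ι → ℝ) × (ι → ℝ)) =>
      ContinuousLinearMap.rotation (Real.pi / 2 * q.1) q.2 := by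
  simp only [ContinuousLinearMap.rotation_apply]
  fun_prop

theorem continuous_quarticDeriv_rotation {ι : Type*} [Fintype ι] (p : (ι → ℝ) × (ι → ℝ)) :
    Continuous fun s : ℝ =>
      quarticDeriv (ContinuousLinearMap.rotation (Real.pi / 2 * s) p) := by
  simp only [quarticDeriv, ContinuousLinearMap.rotation_apply, Pi.add_apply, Pi.smul_apply,
    smul_eq_mul]
  fun_prop

/-- Along the quarter turn the first component runs from `p.1` to `p.2`, and its derivative is π/2
times the second component. The fundamental theorem of calculus applies. -/
theorem integral_quarticDeriv_rotation {ι : Type*} [Fintype ι] (p : (ι → ℝ) × (ι → ℝ)) :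
    ∫ s in (0 : ℝ)..1, Real.pi / 2 *
      quarticDeriv (ContinuousLinearMap.rotation (Real.pi / 2 * s) p) =
      ∑ i, p.2 i ^ 4 - ∑ i, p.1 i ^ 4 := by
  have hc : Continuous fun s : ℝ => Real.pi / 2 *
      quarticDeriv (ContinuousLinearMap.rotation (Real.pi / 2 * s) p) :=
    continuous_const.mul (continuous_quarticDeriv_rotation p)
  have := intervalIntegral.integral_eq_sub_of_hasDerivAt (a := 0) (b := 1)
    (f := fun s : ℝ => ∑ i, (Real.cos (Real.pi / 2 * s) * p.1 i +
      Real.sin (Real.pi / 2 * s) * p.2 i) ^ 4)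
    (f' := fun s => Real.pi / 2 *
      quarticDeriv (ContinuousLinearMap.rotation (Real.pi / 2 * s) p)) (fun s _ => ?_)
    (hc.intervalIntegrable _ _)
  · rw [this]; simp
  · have hlin : HasDerivAt (fun s : ℝ => Real.pi / 2 * s) (Real.pi / 2) s := by
      simpa using (hasDerivAt_id s).const_mul (Real.pi / 2)
    have hi : ∀ i ∈ (Finset.univ : Finset ι), HasDerivAt (fun s : ℝ =>
        (Real.cos (Real.pi / 2 * s) * p.1 i + Real.sin (Real.pi / 2 * s) * p.2 i) ^ 4) _ s :=
      fun i _ => ((hlin.cos.mul_const (p.1 i)).add (hlin.sin.mul_const (p.2 i))).pow 4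
    convert! HasDerivAt.fun_sum hi using 1
    simp only [quarticDeriv, ContinuousLinearMap.rotation_apply, Finset.mul_sum, Pi.add_apply,
      Pi.smul_apply, smul_eq_mul]
    refine Finset.sum_congr rfl fun i _ => ?_
    norm_num
    ring

/-- Jensen's inequality on (0, 1] moves the fourth power inside the integral over the turn. The
lower integral prepares for Tonelli, where no joint integrability is needed. -/
theorem ofReal_sub_pow_four_le_lintegral {ι : Type*} [Fintype ι] (p : (ι → ℝ) × (ι → ℝ)) :
    ENNReal.ofReal ((∑ i, p.1 i ^ 4 - ∑ i, p.2 i ^ 4) ^ 4) ≤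
      ENNReal.ofReal ((Real.pi / 2) ^ 4) * ∫⁻ s in Set.Ioc (0 : ℝ) 1,
        ENNReal.ofReal (quarticDeriv (ContinuousLinearMap.rotation (Real.pi / 2 * s) p) ^ 4) := by
  have hc := continuous_quarticDeriv_rotation p
  have h4 : IntegrableOn (fun s : ℝ =>
      quarticDeriv (ContinuousLinearMap.rotation (Real.pi / 2 * s) p) ^ 4) (Set.Ioc 0 1) :=
    ((hc.pow 4).integrableOn_Icc).mono_set Set.Ioc_subset_Icc_self
  have : IsProbabilityMeasure (volume.restrict (Set.Ioc (0 : ℝ) 1)) := ⟨by simp⟩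
  rw [← ofReal_integral_eq_lintegral_ofReal h4 (ae_of_all _ fun s => by positivity),
    ← ENNReal.ofReal_mul (by positivity)]
  refine ENNReal.ofReal_le_ofReal ?_
  have hI := integral_quarticDeriv_rotation p
  rw [intervalIntegral.integral_const_mul, intervalIntegral.integral_of_le zero_le_one] at hI
  calc (∑ i, p.1 i ^ 4 - ∑ i, p.2 i ^ 4) ^ 4
      = (∑ i, p.2 i ^ 4 - ∑ i, p.1 i ^ 4) ^ 4 := by ring
    _ = (Real.pi / 2) ^ 4 * (∫ s in Set.Ioc (0 : ℝ) 1,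
        quarticDeriv (ContinuousLinearMap.rotation (Real.pi / 2 * s) p)) ^ 4 := by
        rw [← hI, mul_pow]
    _ ≤ _ := by
        refine mul_le_mul_of_nonneg_left (integral_pow_four_le ?_ h4) (by positivity)
        exact (hc.integrableOn_Icc).mono_set Set.Ioc_subset_Icc_self

namespace IsCenteredGaussian

variable {ι : Type*} [Fintype ι] {μ : Measure (ι → ℝ)} {S : ι → ι → ℝ}

/-- After Tonelli, rotation invariance makes the inner integral independent of `s`. -/
theorem lintegral_sub_pow_four_le (h : IsCenteredGaussian μ S) :
    ∫⁻ p, ENNReal.ofReal ((∑ i, p.1 i ^ 4 - ∑ i, p.2 i ^ 4) ^ 4) ∂(μ.prod μ) ≤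
      ENNReal.ofReal ((Real.pi / 2) ^ 4) *
        ∫⁻ p, ENNReal.ofReal (quarticDeriv p ^ 4) ∂(μ.prod μ) := by
  have := h.isGaussian
  have hm : Measurable fun q : ℝ × ((ι → ℝ) × (ι → ℝ)) => ENNReal.ofReal
      (quarticDeriv (ContinuousLinearMap.rotation (Real.pi / 2 * q.1) q.2) ^ 4) :=
    (((continuous_quarticDeriv.comp continuous_rotation).pow 4).measurable).ennreal_ofReal
  have hm' : Measurable fun p : (ι → ℝ) × (ι → ℝ) => ENNReal.ofReal (quarticDeriv p ^ 4) :=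
    ((continuous_quarticDeriv.pow 4).measurable).ennreal_ofReal
  refine (lintegral_mono ofReal_sub_pow_four_le_lintegral).trans ?_
  rw [lintegral_const_mul' _ _ ENNReal.ofReal_ne_top,
    lintegral_lintegral_swap (f := fun p s => ENNReal.ofReal
      (quarticDeriv (ContinuousLinearMap.rotation (Real.pi / 2 * s) p) ^ 4))
      (hm.comp measurable_swap).aemeasurable]
  gcongr
  have hs : ∀ s : ℝ, ∫⁻ p, ENNReal.ofReal
      (quarticDeriv (ContinuousLinearMap.rotation (Real.pi / 2 * s) p) ^ 4) ∂(μ.prod μ) =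
      ∫⁻ p, ENNReal.ofReal (quarticDeriv p ^ 4) ∂(μ.prod μ) := by
    intro s
    conv_rhs => rw [← h.map_rotation (Real.pi / 2 * s)]
    rw [lintegral_map hm' (ContinuousLinearMap.continuous _).measurable]
  simp_rw [hs]
  simp

/-- For fixed x, y ↦ `quarticDeriv (x, y)` is centered Gaussian, so its fourth moment is 3 times the
squared variance. Schur's test bounds the variance by M · 16 ∑ xᵢ⁶, whence 768 = 3 · 16².
Cauchy–Schwarz then reduces (∑ xᵢ⁶)² to twelfth moments. -/
theorem lintegral_quarticDeriv_pow_four_le (h : IsCenteredGaussian μ S)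
    (hS : ∀ i j, S i j = S j i) {M s : ℝ} (hM : ∀ i, ∑ j, |S i j| ≤ M) (hs : ∀ i, S i i ≤ s) :
    ∫⁻ p, ENNReal.ofReal (quarticDeriv p ^ 4) ∂(μ.prod μ) ≤
      ENNReal.ofReal (768 * M ^ 2 * (Fintype.card ι : ℝ) ^ 2 * s ^ 6 *
        ∫ x, x ^ 12 ∂gaussianReal 0 1) := by
  have := h.isGaussian
  have hm' : Measurable fun p : (ι → ℝ) × (ι → ℝ) => ENNReal.ofReal (quarticDeriv p ^ 4) :=
    ((continuous_quarticDeriv.pow 4).measurable).ennreal_ofReal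
  rw [lintegral_prod _ hm'.aemeasurable]
  have hQ : ∀ x : ι → ℝ, ∫⁻ y, ENNReal.ofReal (quarticDeriv (x, y) ^ 4) ∂μ ≤
      ENNReal.ofReal (768 * M ^ 2 * (Fintype.card ι : ℝ) * ∑ i, x i ^ 12) := by
    intro x
    have h4 := (memLp_pow_of_memLp_mul (p := 1) (n := 4) (by norm_num)
      (h.memLp_linear (fun i => 4 * x i ^ 3) (by norm_num))).integrable
      le_rfl
    simp only [quarticDeriv]
    rw [← ofReal_integral_eq_lintegral_ofReal h4 (ae_of_all _ fun y => by positivity),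
      h.integral_sum_mul_pow_four]
    refine ENNReal.ofReal_le_ofReal ?_
    have h1 := quadraticForm_le_of_row_sum_le hS hM (fun i => 4 * x i ^ 3)
    have h2 := pow_le_pow_left₀ (h.nonneg _) h1 2
    have h3 := sq_sum_le_card_mul_sum_sq (s := Finset.univ) (f := fun i => x i ^ 6)
    have e1 : ∑ i, (4 * x i ^ 3) ^ 2 = 16 * ∑ i, x i ^ 6 := by
      rw [Finset.mul_sum]; exact Finset.sum_congr rfl fun i _ => by ring
    have e2 : ∑ i, (x i ^ 6) ^ 2 = ∑ i, x i ^ 12 := Finset.sum_congr rfl fun i _ => by ring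
    rw [e1] at h2
    rw [e2, Finset.card_univ] at h3
    nlinarith [mul_le_mul_of_nonneg_left h3 (by positivity : 0 ≤ 768 * M ^ 2)]
  refine (lintegral_mono hQ).trans ?_
  have hint : ∀ i, Integrable (fun x : ι → ℝ => x i ^ 12) μ := fun i =>
    (h.memLp_eval_pow i (by norm_num) ENNReal.one_ne_top).integrable le_rfl
  rw [← ofReal_integral_eq_lintegral_ofReal ((integrable_finsetSum _ fun i _ => hint i).const_mul _)
    (ae_of_all _ fun x => by
      have : 0 ≤ ∑ i, x i ^ 12 := Finset.sum_nonneg fun i _ => by positivity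
      positivity), integral_const_mul, integral_finsetSum _ fun i _ => hint i]
  refine ENNReal.ofReal_le_ofReal ?_
  have hK : 0 ≤ ∫ x, x ^ 12 ∂gaussianReal 0 1 := integral_nonneg fun x => by positivity
  have hsum : ∑ i, ∫ x, x i ^ 12 ∂μ ≤
      (Fintype.card ι : ℝ) * (s ^ 6 * ∫ x, x ^ 12 ∂gaussianReal 0 1) := by
    rw [← nsmul_eq_mul, ← Finset.card_univ, ← Finset.sum_const]
    refine Finset.sum_le_sum fun i _ => ?_
    rw [h.integral_pow_eval i 6]
    exact mul_le_mul_of_nonneg_right (pow_le_pow_left₀ (h.diag_nonneg i) (hs i) 6) hK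
  calc _ ≤ 768 * M ^ 2 * (Fintype.card ι : ℝ) *
        ((Fintype.card ι : ℝ) * (s ^ 6 * ∫ x, x ^ 12 ∂gaussianReal 0 1)) :=
        mul_le_mul_of_nonneg_left hsum (by positivity)
    _ = _ := by ring

/-- Symmetrization: averaging over the independent copy y replaces its quartic sum by the mean, and
Jensen gives the inequality. -/
theorem lintegral_centered_pow_four_le (h : IsCenteredGaussian μ S) :
    ∫⁻ x, ENNReal.ofReal ((∑ i, x i ^ 4 - ∑ i, 3 * S i i ^ 2) ^ 4) ∂μ ≤
      ∫⁻ p, ENNReal.ofReal ((∑ i, p.1 i ^ 4 - ∑ i, p.2 i ^ 4) ^ 4) ∂(μ.prod μ) := by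
  have := h.isGaussian
  rw [lintegral_prod _ (by fun_prop)]
  refine lintegral_mono fun x => ?_
  have hF : ∀ {p : ℝ≥0∞}, p ≠ ∞ →
      MemLp (fun y : ι → ℝ => ∑ i, x i ^ 4 - ∑ i, y i ^ 4) p μ := fun hp =>
    (memLp_const _).sub (h.memLp_sum_pow_four hp)
  have h1 := (hF ENNReal.one_ne_top).integrable le_rfl
  have h4 := (memLp_pow_of_memLp_mul (p := 1) (n := 4) (by norm_num)
      (hF (by norm_num))).integrable le_rfl
  rw [← ofReal_integral_eq_lintegral_ofReal h4 (ae_of_all _ fun y => by positivity)]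
  refine ENNReal.ofReal_le_ofReal (le_trans (le_of_eq ?_) (integral_pow_four_le h1 h4))
  rw [integral_sub (integrable_const _)
    ((h.memLp_sum_pow_four ENNReal.one_ne_top).integrable le_rfl), h.integral_sum_pow_four]
  simp

/-- A fourth moment bound for the centered quartic form of a Gaussian vector. -/
theorem lintegral_quartic_le (h : IsCenteredGaussian μ S)
    (hS : ∀ i j, S i j = S j i) {M s : ℝ} (hM : ∀ i, ∑ j, |S i j| ≤ M) (hs : ∀ i, S i i ≤ s) :
    ∫⁻ x, ENNReal.ofReal ((∑ i, x i ^ 4 - ∑ i, 3 * S i i ^ 2) ^ 4) ∂μ ≤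
      ENNReal.ofReal ((Real.pi / 2) ^ 4 * (768 * M ^ 2 * (Fintype.card ι : ℝ) ^ 2 * s ^ 6 *
        ∫ x, x ^ 12 ∂gaussianReal 0 1)) := by
  rw [ENNReal.ofReal_mul (by positivity)]
  refine h.lintegral_centered_pow_four_le.trans (h.lintegral_sub_pow_four_le.trans ?_)
  gcongr
  exact h.lintegral_quarticDeriv_pow_four_le hS hM hs

end IsCenteredGaussian

/-! ### Wiener integrals: Gaussianity and isometry. -/

section

theorem integral_sq_eq_toReal_eLpNorm_sq {α : Type*} [MeasurableSpace α] {μ : Measure α}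
    {f : α → ℝ} (hf : MemLp f 2 μ) : ∫ x, f x ^ 2 ∂μ = (eLpNorm f 2 μ).toReal ^ 2 := by
  have h0 : 0 ≤ ∫ x, f x ^ 2 ∂μ := integral_nonneg fun x => sq_nonneg _
  rw [hf.eLpNorm_eq_integral_rpow_norm two_ne_zero ENNReal.ofNat_ne_top]
  simp only [ENNReal.toReal_ofNat, Real.rpow_ofNat, Real.norm_eq_abs, sq_abs]
  rw [ENNReal.toReal_ofReal (by positivity), ← Real.rpow_natCast, ← Real.rpow_mul h0]
  norm_num

theorem tendsto_integral_sq_of_tendsto_eLpNorm {α : Type*} [MeasurableSpace α] {μ : Measure α}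
    {g : ℕ → α → ℝ} {f : α → ℝ} (hg : ∀ n, MemLp (g n) 2 μ) (hf : MemLp f 2 μ)
    (h : Tendsto (fun n => eLpNorm (g n - f) 2 μ) atTop (𝓝 0)) :
    Tendsto (fun n => ∫ x, g n x ^ 2 ∂μ) atTop (𝓝 (∫ x, f x ^ 2 ∂μ)) := by
  have h1 := ((Lp.tendsto_Lp_iff_tendsto_eLpNorm'' g hg f hf).2 h).norm.pow 2
  simp only [Lp.norm_toLp] at h1
  simp_rw [integral_sq_eq_toReal_eLpNorm_sq (hg _), integral_sq_eq_toReal_eLpNorm_sq hf]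
  exact h1

/-- An `L²`-limit of centered Gaussian variables is centered Gaussian. -/
theorem map_eq_gaussianReal_of_tendsto_eLpNorm {Ω : Type*} [MeasurableSpace Ω] {P : Measure Ω}
    [IsProbabilityMeasure P] {X : ℕ → Ω → ℝ} {Y : Ω → ℝ} {v : ℕ → ℝ} {w : ℝ}
    (hX : ∀ n, AEMeasurable (X n) P) (hY : AEMeasurable Y P)
    (hmap : ∀ n, P.map (X n) = gaussianReal 0 (v n).toNNReal)
    (hlim : Tendsto (fun n => eLpNorm (X n - Y) 2 P) atTop (𝓝 0))
    (hv : Tendsto v atTop (𝓝 w)) : P.map Y = gaussianReal 0 w.toNNReal := by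
  have := Measure.isProbabilityMeasure_map (μ := P) hY
  refine Measure.ext_of_charFun (funext fun t => ?_)
  -- An almost surely convergent subsequence suffices: dominated convergence gives the
  -- characteristic function of the limit, and the variances converge along it too.
  obtain ⟨ns, hns, hae⟩ := (tendstoInMeasure_of_tendsto_eLpNorm two_ne_zero
    (fun n => (hX n).aestronglyMeasurable) hY.aestronglyMeasurable hlim).exists_seq_tendsto_ae
  have hc : ∀ {Z : Ω → ℝ}, AEMeasurable Z P →
      charFun (P.map Z) t = ∫ ω, Complex.exp (t * Z ω * Complex.I) ∂P := by
    intro Z hZ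
    rw [charFun_apply_real, integral_map hZ (by fun_prop)]
  have h1 : Tendsto (fun k => charFun (P.map (X (ns k))) t) atTop (𝓝 (charFun (P.map Y) t)) := by
    rw [hc hY]
    simp_rw [hc (hX _)]
    refine tendsto_integral_of_dominated_convergence (fun _ => 1) (fun n => ?_)
      (integrable_const _) (fun n => ae_of_all _ fun ω => ?_) ?_
    · have := hX (ns n)
      exact (by fun_prop : AEMeasurable _ P).aestronglyMeasurable
    · rw [← Complex.ofReal_mul, Complex.norm_exp_ofReal_mul_I]
    · filter_upwards [hae] with ω hω
      have hcont : Continuous fun y : ℝ => Complex.exp (t * y * Complex.I) := by fun_prop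
      exact (hcont.tendsto _).comp hω
  refine tendsto_nhds_unique h1 ?_
  simp_rw [hmap, charFun_gaussianReal]
  have hcont : Continuous fun y : ℝ => Complex.exp (t * (0 : ℝ) * Complex.I -
      (y.toNNReal : ℝ) * t ^ 2 / 2) := by fun_prop
  exact (hcont.tendsto w).comp (hv.comp hns.tendsto_atTop)

theorem elementaryFun_add (c d : (ℝ≥0 × BoundedBorel) →₀ ℝ) (z : ℝ × ℝ) :
    elementaryFun (c + d) z = elementaryFun c z + elementaryFun d z := by
  unfold elementaryFun
  rw [Finsupp.sum_add_index'] <;> intros <;> ring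

theorem elementaryFun_smul (a : ℝ) (c : (ℝ≥0 × BoundedBorel) →₀ ℝ) (z : ℝ × ℝ) :
    elementaryFun (a • c) z = a * elementaryFun c z := by
  unfold elementaryFun
  rw [Finsupp.sum_smul_index' (by simp), Finsupp.mul_sum]
  simp only [smul_eq_mul, mul_assoc]

theorem memLp_box_indicator (p : ℝ≥0 × BoundedBorel) :
    MemLp ((Set.Ioc (0 : ℝ) p.1 ×ˢ p.2.1).indicator fun _ => (1 : ℝ)) 2 spaceTime := by
  refine memLp_indicator_const 2 (measurableSet_Ioc.prod p.2.2.1) 1 (Or.inr (ne_of_lt ?_))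
  refine lt_of_le_of_lt (Measure.restrict_apply_le _ _) ?_
  rw [Measure.volume_eq_prod, Measure.prod_prod]
  exact ENNReal.mul_lt_top (by simp) p.2.2.2.measure_lt_top

theorem memLp_elementaryFun (c : (ℝ≥0 × BoundedBorel) →₀ ℝ) :
    MemLp (elementaryFun c) 2 spaceTime :=
  memLp_finsetSum _ fun p _ => (memLp_box_indicator p).const_mul _

theorem integral_box_indicator_mul (p q : ℝ≥0 × BoundedBorel) :
    ∫ z, (Set.Ioc (0 : ℝ) p.1 ×ˢ p.2.1).indicator (fun _ => (1 : ℝ)) z *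
      (Set.Ioc (0 : ℝ) q.1 ×ˢ q.2.1).indicator (fun _ => (1 : ℝ)) z ∂spaceTime =
      ((min p.1 q.1 : ℝ≥0) : ℝ) * volume.real (p.2.1 ∩ q.2.1) := by
  have h1 : ∀ z, (Set.Ioc (0 : ℝ) p.1 ×ˢ p.2.1).indicator (fun _ => (1 : ℝ)) z *
      (Set.Ioc (0 : ℝ) q.1 ×ˢ q.2.1).indicator (fun _ => (1 : ℝ)) z =
      (Set.Ioc (0 : ℝ) (min p.1 q.1 : ℝ≥0) ×ˢ (p.2.1 ∩ q.2.1)).indicator (fun _ => (1 : ℝ)) z := by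
    intro z
    rw [← Set.inter_indicator_mul, Set.prod_inter_prod, Set.Ioc_inter_Ioc]
    simp
  have hm : MeasurableSet (Set.Ioc (0 : ℝ) (min p.1 q.1 : ℝ≥0) ×ˢ (p.2.1 ∩ q.2.1)) :=
    measurableSet_Ioc.prod (p.2.2.1.inter q.2.2.1)
  simp_rw [h1]
  rw [integral_indicator_const _ hm, spaceTime, measureReal_restrict_apply hm,
    Set.inter_eq_left.2]
  · rw [Measure.volume_eq_prod, measureReal_prod_prod]
    simp only [measureReal_def, Real.volume_Ioc, sub_zero, ENNReal.ofReal_coe_nnreal,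
      ENNReal.coe_toReal, smul_eq_mul, mul_one]
  · exact Set.prod_mono Set.Ioc_subset_Ioi_self (Set.subset_univ _)

theorem elementaryIntegral_add {Ω : Type*} {W : ℝ≥0 → BoundedBorel → Ω → ℝ}
    (c d : (ℝ≥0 × BoundedBorel) →₀ ℝ) (ω : Ω) :
    elementaryIntegral W (c + d) ω = elementaryIntegral W c ω + elementaryIntegral W d ω := by
  unfold elementaryIntegral
  rw [Finsupp.sum_add_index'] <;> intros <;> ring

theorem elementaryIntegral_smul {Ω : Type*} {W : ℝ≥0 → BoundedBorel → Ω → ℝ}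
    (a : ℝ) (c : (ℝ≥0 × BoundedBorel) →₀ ℝ) (ω : Ω) :
    elementaryIntegral W (a • c) ω = a * elementaryIntegral W c ω := by
  unfold elementaryIntegral
  rw [Finsupp.sum_smul_index' (by simp), Finsupp.mul_sum]
  simp only [smul_eq_mul, mul_assoc]

variable {Ω : Type*} [MeasurableSpace Ω] {P : Measure Ω} {W : ℝ≥0 → BoundedBorel → Ω → ℝ}

namespace IsSpaceTimeWhiteNoise

theorem memLp (hW : IsSpaceTimeWhiteNoise W P) (p : ℝ≥0 × BoundedBorel) :
    MemLp (W p.1 p.2) 2 P :=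
  (hW.gaussian.hasGaussianLaw_eval p).memLp_two

theorem memLp_elementaryIntegral (hW : IsSpaceTimeWhiteNoise W P)
    (c : (ℝ≥0 × BoundedBorel) →₀ ℝ) : MemLp (elementaryIntegral W c) 2 P :=
  memLp_finsetSum _ fun p _ => (hW.memLp p).const_mul _

/-- Both sides expand to the same quadratic form, since the noise covariance equals the L² inner
product of the boxes. -/
theorem integral_elementaryIntegral_sq (hW : IsSpaceTimeWhiteNoise W P)
    (c : (ℝ≥0 × BoundedBorel) →₀ ℝ) :
    ∫ ω, elementaryIntegral W c ω ^ 2 ∂P = ∫ z, elementaryFun c z ^ 2 ∂spaceTime := by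
  have hl : ∀ ω, elementaryIntegral W c ω ^ 2 = ∑ p ∈ c.support, ∑ q ∈ c.support,
      c p * c q * (W p.1 p.2 ω * W q.1 q.2 ω) := by
    intro ω
    rw [sq, elementaryIntegral, Finsupp.sum, Finset.sum_mul_sum]
    exact Finset.sum_congr rfl fun p _ => Finset.sum_congr rfl fun q _ => by ring
  have hr : ∀ z, elementaryFun c z ^ 2 = ∑ p ∈ c.support, ∑ q ∈ c.support,
      c p * c q * ((Set.Ioc (0 : ℝ) p.1 ×ˢ p.2.1).indicator (fun _ => (1 : ℝ)) z *
      (Set.Ioc (0 : ℝ) q.1 ×ˢ q.2.1).indicator (fun _ => (1 : ℝ)) z) := by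
    intro z
    rw [sq, elementaryFun, Finsupp.sum, Finset.sum_mul_sum]
    exact Finset.sum_congr rfl fun p _ => Finset.sum_congr rfl fun q _ => by ring
  have il : ∀ p q : ℝ≥0 × BoundedBorel, Integrable
      (fun ω => c p * c q * (W p.1 p.2 ω * W q.1 q.2 ω)) P := fun p q =>
    ((hW.memLp p).integrable_mul (hW.memLp q)).const_mul _
  have ir : ∀ p q : ℝ≥0 × BoundedBorel, Integrable (fun z =>
      c p * c q * ((Set.Ioc (0 : ℝ) p.1 ×ˢ p.2.1).indicator (fun _ => (1 : ℝ)) z *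
      (Set.Ioc (0 : ℝ) q.1 ×ˢ q.2.1).indicator (fun _ => (1 : ℝ)) z)) spaceTime := fun p q =>
    ((memLp_box_indicator p).integrable_mul (memLp_box_indicator q)).const_mul _
  simp_rw [hl, hr]
  rw [integral_finsetSum _ fun p _ => integrable_finsetSum _ fun q _ => il p q,
    integral_finsetSum _ fun p _ => integrable_finsetSum _ fun q _ => ir p q]
  refine Finset.sum_congr rfl fun p _ => ?_
  rw [integral_finsetSum _ fun q _ => il p q, integral_finsetSum _ fun q _ => ir p q]
  refine Finset.sum_congr rfl fun q _ => ?_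
  rw [integral_const_mul, integral_const_mul, hW.covariance, integral_box_indicator_mul]

theorem map_elementaryIntegral (hW : IsSpaceTimeWhiteNoise W P)
    (c : (ℝ≥0 × BoundedBorel) →₀ ℝ) :
    P.map (elementaryIntegral W c) =
      gaussianReal 0 (∫ z, elementaryFun c z ^ 2 ∂spaceTime).toNNReal := by
  have := hW.gaussian.isProbabilityMeasure
  have hG : HasGaussianLaw (elementaryIntegral W c) P :=
    (hW.gaussian.smul fun p => c p).hasGaussianLaw_fun_sum (I := c.support)
  have h0 : ∫ ω, elementaryIntegral W c ω ∂P = 0 := by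
    unfold elementaryIntegral Finsupp.sum
    rw [integral_finsetSum]
    · exact Finset.sum_eq_zero fun p _ => by rw [integral_const_mul, hW.centered, mul_zero]
    · exact fun p _ => ((hW.memLp p).integrable one_le_two).const_mul _
  rw [hG.map_eq_gaussianReal, h0, variance_of_integral_eq_zero hG.aemeasurable h0,
    hW.integral_elementaryIntegral_sq]

end IsSpaceTimeWhiteNoise

namespace IsWienerIntegral

variable {f g : ℝ × ℝ → ℝ} {X Y : Ω → ℝ}

theorem map_eq (hX : IsWienerIntegral W P f X) (hW : IsSpaceTimeWhiteNoise W P) :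
    P.map X = gaussianReal 0 (∫ z, f z ^ 2 ∂spaceTime).toNNReal := by
  have := hW.gaussian.isProbabilityMeasure
  obtain ⟨hf, hX2, c, hcf, hcX⟩ := hX
  exact map_eq_gaussianReal_of_tendsto_eLpNorm
    (fun n => (hW.memLp_elementaryIntegral (c n)).1.aemeasurable) hX2.1.aemeasurable
    (fun n => hW.map_elementaryIntegral (c n)) hcX
    (tendsto_integral_sq_of_tendsto_eLpNorm (fun n => memLp_elementaryFun (c n)) hf hcf)

theorem zero : IsWienerIntegral W P (fun _ => 0) (fun _ => 0) := by
  refine ⟨MemLp.zero, MemLp.zero, fun _ => 0, ?_, ?_⟩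
  · simp [elementaryFun]
  · simp [elementaryIntegral]

theorem add (hW : IsSpaceTimeWhiteNoise W P) (hX : IsWienerIntegral W P f X)
    (hY : IsWienerIntegral W P g Y) :
    IsWienerIntegral W P (fun z => f z + g z) (fun ω => X ω + Y ω) := by
  obtain ⟨hf, hX2, c, hcf, hcX⟩ := hX
  obtain ⟨hg, hY2, d, hdg, hdY⟩ := hY
  refine ⟨hf.add hg, hX2.add hY2, fun n => c n + d n, ?_, ?_⟩
  · refine tendsto_of_tendsto_of_tendsto_of_le_of_le tendsto_const_nhds
      (by simpa using hcf.add hdg) (fun _ => zero_le) fun n => ?_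
    refine le_trans (le_of_eq (congrArg (fun h => eLpNorm h 2 spaceTime) (funext fun z => ?_)))
      (eLpNorm_add_le ((memLp_elementaryFun (c n)).sub hf).1
        ((memLp_elementaryFun (d n)).sub hg).1 one_le_two)
    simp only [elementaryFun_add, Pi.add_apply]; ring
  · refine tendsto_of_tendsto_of_tendsto_of_le_of_le tendsto_const_nhds
      (by simpa using hcX.add hdY) (fun _ => zero_le) fun n => ?_
    refine le_trans (le_of_eq (congrArg (fun h => eLpNorm h 2 P) (funext fun z => ?_)))
      (eLpNorm_add_le ((hW.memLp_elementaryIntegral (c n)).sub hX2).1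
        ((hW.memLp_elementaryIntegral (d n)).sub hY2).1 one_le_two)
    simp only [elementaryIntegral_add, Pi.add_apply]; ring

theorem const_mul (a : ℝ) (hX : IsWienerIntegral W P f X) :
    IsWienerIntegral W P (fun z => a * f z) (fun ω => a * X ω) := by
  obtain ⟨hf, hX2, c, hcf, hcX⟩ := hX
  have key : ∀ {u : ℕ → ℝ≥0∞}, Tendsto u atTop (𝓝 0) →
      Tendsto (fun n => ‖a‖ₑ * u n) atTop (𝓝 0) := fun hu => by
    simpa using ENNReal.Tendsto.const_mul hu (Or.inr enorm_ne_top)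
  refine ⟨hf.const_mul a, hX2.const_mul a, fun n => a • c n, ?_, ?_⟩
  · convert! key hcf using 2 with n
    rw [← eLpNorm_const_smul]
    congr 1; ext z
    simp only [elementaryFun_smul, Pi.smul_apply, smul_eq_mul]; ring
  · convert! key hcX using 2 with n
    rw [← eLpNorm_const_smul]
    congr 1; ext z
    simp only [elementaryIntegral_smul, Pi.smul_apply, smul_eq_mul]; ring

theorem sub (hW : IsSpaceTimeWhiteNoise W P) (hX : IsWienerIntegral W P f X)
    (hY : IsWienerIntegral W P g Y) :
    IsWienerIntegral W P (fun z => f z - g z) (fun ω => X ω - Y ω) := by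
  simpa [sub_eq_add_neg] using hX.add hW (hY.const_mul (-1))

theorem sum {ι : Type*} (s : Finset ι) (hW : IsSpaceTimeWhiteNoise W P)
    {f : ι → ℝ × ℝ → ℝ} {X : ι → Ω → ℝ} (h : ∀ i, IsWienerIntegral W P (f i) (X i))
    (a : ι → ℝ) :
    IsWienerIntegral W P (fun z => ∑ i ∈ s, a i * f i z) (fun ω => ∑ i ∈ s, a i * X i ω) := by
  classical
  induction s using Finset.induction_on with
  | empty => simpa using zero
  | insert i s hi ih =>
    simp only [Finset.sum_insert hi]
    exact ((h i).const_mul (a i)).add hW ih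

/-- Wiener integrals are jointly centered Gaussian, and the Wiener integral is an isometry. -/
theorem isCenteredGaussian {ι : Type*} [Fintype ι] (hW : IsSpaceTimeWhiteNoise W P)
    {f : ι → ℝ × ℝ → ℝ} {X : ι → Ω → ℝ} (h : ∀ i, IsWienerIntegral W P (f i) (X i)) :
    IsCenteredGaussian (P.map fun ω i => X i ω) fun i j => ∫ z, f i z * f j z ∂spaceTime := by
  have hq : ∀ a : ι → ℝ, ∫ z, (∑ i, a i * f i z) ^ 2 ∂spaceTime =
      ∑ i, ∑ j, a i * a j * ∫ z, f i z * f j z ∂spaceTime := by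
    intro a
    have hr : ∀ z, (∑ i, a i * f i z) ^ 2 = ∑ i, ∑ j, a i * a j * (f i z * f j z) := by
      intro z
      rw [sq, Finset.sum_mul_sum]
      exact Finset.sum_congr rfl fun p _ => Finset.sum_congr rfl fun q _ => by ring
    have ir : ∀ i j, Integrable (fun z => a i * a j * (f i z * f j z)) spaceTime := fun i j =>
      ((h i).1.integrable_mul (h j).1).const_mul _
    simp_rw [hr]
    rw [integral_finsetSum _ fun p _ => integrable_finsetSum _ fun q _ => ir p q]
    refine Finset.sum_congr rfl fun p _ => ?_
    rw [integral_finsetSum _ fun q _ => ir p q]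
    exact Finset.sum_congr rfl fun q _ => integral_const_mul _ _
  refine ⟨fun a => ?_, fun a => ?_⟩
  · rw [← hq]; exact integral_nonneg fun z => sq_nonneg _
  -- A linear combination of Wiener integrals is again one, so the one-dimensional law yields the
  -- joint law.
  · rw [← hq, ← (sum Finset.univ hW h a).map_eq hW,
      AEMeasurable.map_map_of_aemeasurable (by fun_prop : Measurable _).aemeasurable
        (aemeasurable_pi_lambda _ fun i => (h i).2.1.1.aemeasurable)]
    rfl

end IsWienerIntegral

end

/-! ### Time covariance of the mild solution. -/

/-- The semigroup property evaluated at the origin: G(a) ∗ G(b) at 0 is G(a + b, 0). Translation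
removes `x`. -/
theorem integral_heatKernel_mul_heatKernel {a b : ℝ} (ha : 0 < a) (hb : 0 < b) (x : ℝ) :
    ∫ y, heatKernel a (x - y) * heatKernel b (x - y) = 1 / √(2 * Real.pi * (a + b)) := by
  rw [integral_sub_left_eq_self (fun z => heatKernel a z * heatKernel b z) volume x]
  have h1 : ∀ z, heatKernel a z * heatKernel b z = 1 / (√(2 * Real.pi * a) * √(2 * Real.pi * b)) *
      Real.exp (-((a + b) / (2 * a * b)) * z ^ 2) := by
    intro z
    unfold heatKernel
    rw [show -((a + b) / (2 * a * b)) * z ^ 2 = -z ^ 2 / (2 * a) + -z ^ 2 / (2 * b) by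
      field_simp; ring, Real.exp_add]
    field_simp
  have hpi := Real.pi_pos
  simp_rw [h1]
  rw [integral_const_mul, integral_gaussian, ← Real.sqrt_mul (by positivity),
    one_div_mul_eq_div, ← Real.sqrt_div (by positivity), one_div (√(2 * Real.pi * (a + b))), ← Real.sqrt_inv]
  congr 1
  field_simp

theorem integral_inv_sqrt_sub {s t : ℝ} (hs : 0 ≤ s) (hst : s ≤ t) :
    ∫ r in (0 : ℝ)..s, 1 / √(t + s - 2 * r) = √(t + s) - √(t - s) := by
  refine (intervalIntegral.integral_comp_sub_mul (a := 0) (b := s) (fun y : ℝ => 1 / √y)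
    two_ne_zero (t + s)).trans ?_
  -- Rewriting as a power of exponent above −1 covers the case s = t, where the integrand is
  -- singular at the endpoint.
  have h2 : ∫ y in (t + s - 2 * s)..(t + s - 2 * 0), 1 / √y =
      ∫ y in (t + s - 2 * s)..(t + s - 2 * 0), y ^ (-(1 / 2) : ℝ) := by
    refine intervalIntegral.integral_congr fun y hy => ?_
    rw [Set.uIcc_of_le (by linarith)] at hy
    have : 0 ≤ y := by linarith [hy.1]
    simp only [one_div]
    rw [Real.rpow_neg this, ← one_div 2, Real.sqrt_eq_rpow]
  rw [h2, integral_rpow (Or.inl (by norm_num))]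
  rw [show (-(1 / 2) : ℝ) + 1 = 1 / 2 by norm_num, ← Real.sqrt_eq_rpow, ← Real.sqrt_eq_rpow]
  rw [show t + s - 2 * s = t - s by ring, show t + s - 2 * 0 = t + s by ring, smul_eq_mul]
  ring

theorem spaceTime_eq_prod :
    spaceTime = (volume.restrict (Set.Ioi (0 : ℝ))).prod volume := by
  rw [spaceTime, Measure.volume_eq_prod, ← Measure.prod_restrict, Measure.restrict_univ]

/-- The covariance of the mild solution at two times, at the same point of space. -/
theorem integral_mildIntegrand_mul_of_le {θ : ℝ} (hθ : 0 < θ) {s t : ℝ≥0} (hst : s ≤ t) (x : ℝ)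
    (hs : MemLp (mildIntegrand θ s x) 2 spaceTime)
    (ht : MemLp (mildIntegrand θ t x) 2 spaceTime) :
    ∫ z, mildIntegrand θ t x z * mildIntegrand θ s x z ∂spaceTime =
      1 / √(2 * Real.pi * θ) * (√((t : ℝ) + s) - √|(t : ℝ) - s|) := by
  have hst' : (s : ℝ) ≤ t := hst
  have hint : Integrable (fun z => mildIntegrand θ t x z * mildIntegrand θ s x z)
      ((volume.restrict (Set.Ioi (0 : ℝ))).prod volume) := by
    rw [← spaceTime_eq_prod]; exact ht.integrable_mul hs
  rw [spaceTime_eq_prod, integral_prod _ hint]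
  -- Only noise before the earlier time `s` contributes to both factors.
  have hin : ∀ r : ℝ, ∫ y, mildIntegrand θ t x (r, y) * mildIntegrand θ s x (r, y) =
      (Set.Ioo (0 : ℝ) s).indicator
        (fun r => 1 / √(2 * Real.pi * θ) * (1 / √((t : ℝ) + s - 2 * r))) r := by
    intro r
    by_cases hr : r ∈ Set.Ioo (0 : ℝ) s
    · have hrt : r ∈ Set.Ioo (0 : ℝ) t := ⟨hr.1, hr.2.trans_le hst'⟩
      simp only [mildIntegrand, Set.indicator_of_mem hr, Set.indicator_of_mem hrt]
      rw [integral_heatKernel_mul_heatKernel (mul_pos hθ (by linarith [hrt.2]))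
        (mul_pos hθ (by linarith [hr.2])), one_div_mul_one_div,
        ← Real.sqrt_mul (by positivity)]
      congr 2; ring
    · simp [mildIntegrand, Set.indicator_of_notMem hr]
  simp_rw [hin]
  rw [integral_indicator measurableSet_Ioo, Measure.restrict_restrict measurableSet_Ioo,
    Set.inter_eq_left.2 Set.Ioo_subset_Ioi_self, ← integral_Ioc_eq_integral_Ioo,
    ← intervalIntegral.integral_of_le s.coe_nonneg, intervalIntegral.integral_const_mul,
    integral_inv_sqrt_sub s.coe_nonneg hst', abs_of_nonneg (by linarith)]

theorem integral_mildIntegrand_mul {θ : ℝ} (hθ : 0 < θ) (s t : ℝ≥0) (x : ℝ)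
    (hs : MemLp (mildIntegrand θ s x) 2 spaceTime)
    (ht : MemLp (mildIntegrand θ t x) 2 spaceTime) :
    ∫ z, mildIntegrand θ t x z * mildIntegrand θ s x z ∂spaceTime =
      1 / √(2 * Real.pi * θ) * (√((t : ℝ) + s) - √|(t : ℝ) - s|) := by
  rcases le_total s t with h | h
  · exact integral_mildIntegrand_mul_of_le hθ h x hs ht
  · simp_rw [mul_comm (mildIntegrand θ t x _)]
    rw [integral_mildIntegrand_mul_of_le hθ h x ht hs, add_comm (s : ℝ), abs_sub_comm]

/-! ### Increment covariances as second differences of the square root. -/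

/-- The forward difference of the square root at `k`. -/
def sqrtDiff (k : ℕ) : ℝ := √(k + 1) - √k

/-- Minus the second forward difference of the square root at `k`. -/
def sqrtDiff₂ (k : ℕ) : ℝ := sqrtDiff k - sqrtDiff (k + 1)

theorem sqrtDiff_nonneg (k : ℕ) : 0 ≤ sqrtDiff k :=
  sub_nonneg.2 (Real.sqrt_le_sqrt (by linarith))

/-- Midpoint concavity of the square root at k, k + 1, k + 2. -/
theorem sqrtDiff₂_nonneg (k : ℕ) : 0 ≤ sqrtDiff₂ k := by
  have h0 : (0 : ℝ) ≤ k := k.cast_nonneg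
  have h := (concaveOn_iff_forall_pos.1 Real.strictConcaveOn_sqrt.concaveOn).2
    (Set.mem_Ici.2 h0) (Set.mem_Ici.2 (by linarith : (0 : ℝ) ≤ k + 1 + 1))
    (by norm_num : (0 : ℝ) < 1 / 2) (by norm_num : (0 : ℝ) < 1 / 2) (by norm_num)
  simp only [smul_eq_mul] at h
  rw [show 1 / 2 * (k : ℝ) + 1 / 2 * (k + 1 + 1) = k + 1 by ring] at h
  unfold sqrtDiff₂ sqrtDiff
  push_cast
  linarith

theorem sqrtDiff_zero : sqrtDiff 0 = 1 := by simp [sqrtDiff]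

theorem sqrtDiff_le_one (k : ℕ) : sqrtDiff k ≤ 1 := by
  induction k with
  | zero => exact sqrtDiff_zero.le
  | succ k ih => exact (sub_nonneg.1 (sqrtDiff₂_nonneg k)).trans ih

theorem sqrtDiff₂_le_one (k : ℕ) : sqrtDiff₂ k ≤ 1 :=
  (sub_le_self _ (sqrtDiff_nonneg _)).trans (sqrtDiff_le_one k)

theorem sum_sqrtDiff₂_add_le_one (m n : ℕ) : ∑ k ∈ Finset.range n, sqrtDiff₂ (m + k) ≤ 1 := by
  have : ∑ k ∈ Finset.range n, sqrtDiff₂ (m + k) = sqrtDiff m - sqrtDiff (m + n) :=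
    Finset.sum_range_sub' (fun k => sqrtDiff (m + k)) n
  rw [this]
  exact (sub_le_self _ (sqrtDiff_nonneg _)).trans (sqrtDiff_le_one m)

/-- Adding the omitted nonnegative odd-indexed terms makes the sum telescope. -/
theorem sum_sqrtDiff₂_two_mul_le_one (n : ℕ) : ∑ i ∈ Finset.range n, sqrtDiff₂ (2 * i) ≤ 1 := by
  have h : ∑ i ∈ Finset.range n, (sqrtDiff (2 * i) - sqrtDiff (2 * (i + 1))) =
      sqrtDiff (2 * 0) - sqrtDiff (2 * n) :=
    Finset.sum_range_sub' (fun k => sqrtDiff (2 * k)) n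
  have h1 : ∑ i ∈ Finset.range n, sqrtDiff₂ (2 * i) ≤
      ∑ i ∈ Finset.range n, (sqrtDiff (2 * i) - sqrtDiff (2 * (i + 1))) := by
    refine Finset.sum_le_sum fun i _ => sub_le_sub_left ?_ _
    exact sub_nonneg.1 (sqrtDiff₂_nonneg (2 * i + 1))
  rw [h] at h1
  exact h1.trans ((sub_le_self _ (sqrtDiff_nonneg _)).trans (sqrtDiff_le_one _))

/-- The covariance, up to a constant, of the values of the solution at two grid times. -/
def gridCov (i j : ℕ) : ℝ := √((i : ℝ) + j) - √|(i : ℝ) - j|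

/-- The covariance, up to a constant, of the increments of the solution over two grid cells. -/
def incCov (i j : ℕ) : ℝ :=
  gridCov (i + 1) (j + 1) - gridCov (i + 1) j - gridCov i (j + 1) + gridCov i j

theorem gridCov_comm (i j : ℕ) : gridCov i j = gridCov j i := by
  unfold gridCov; rw [add_comm, abs_sub_comm]

theorem incCov_comm (i j : ℕ) : incCov i j = incCov j i := by
  unfold incCov
  rw [gridCov_comm (i + 1) (j + 1), gridCov_comm (i + 1) j, gridCov_comm i (j + 1),
    gridCov_comm i j]
  ring

theorem gridCov_add (i k : ℕ) : gridCov i (i + k) = √((2 * i + k : ℕ) : ℝ) - √k := by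
  unfold gridCov
  push_cast
  rw [show (i : ℝ) - (i + k) = -k by ring, abs_neg, abs_of_nonneg k.cast_nonneg]
  congr 2; ring

/-- The 2 comes from the √|i − j| part; the correction comes from √(i + j) and reflects the start
from zero at time 0. -/
theorem incCov_self (i : ℕ) : incCov i i = 2 - sqrtDiff₂ (2 * i) := by
  have h1 := gridCov_add (i + 1) 0
  have h2 := gridCov_add i 1
  have h3 := gridCov_add i 0
  simp only [add_zero] at h1 h3
  unfold incCov
  rw [gridCov_comm (i + 1) i, h1, h2, h3]
  unfold sqrtDiff₂ sqrtDiff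
  push_cast
  rw [show 2 * ((i : ℝ) + 1) = 2 * i + 1 + 1 by ring]
  simp only [Real.sqrt_zero, Real.sqrt_one]
  ring

/-- Both terms are nonpositive, so absolute values add without loss and row sums telescope. -/
theorem incCov_add (i k : ℕ) :
    incCov i (i + 1 + k) = -sqrtDiff₂ (2 * i + 1 + k) - sqrtDiff₂ k := by
  have h1 := gridCov_add (i + 1) (k + 1)
  have h2 := gridCov_add (i + 1) k
  have h3 := gridCov_add i (k + 2)
  have h4 := gridCov_add i (k + 1)
  unfold incCov
  rw [show i + 1 + k + 1 = i + 1 + (k + 1) by ring, h1, h2,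
    show i + 1 + (k + 1) = i + (k + 2) by ring, h3, show i + 1 + k = i + (k + 1) by ring, h4]
  unfold sqrtDiff₂ sqrtDiff
  push_cast
  rw [show 2 * ((i : ℝ) + 1) + (k + 1) = 2 * i + 1 + k + 1 + 1 by ring,
    show 2 * ((i : ℝ) + 1) + k = 2 * i + 1 + k + 1 by ring,
    show 2 * (i : ℝ) + (k + 2) = 2 * i + 1 + k + 1 by ring,
    show 2 * (i : ℝ) + (k + 1) = 2 * i + 1 + k by ring,
    show (k : ℝ) + 2 = k + 1 + 1 by ring]
  ring

theorem incCov_self_nonneg (i : ℕ) : 0 ≤ incCov i i := by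
  rw [incCov_self]; linarith [sqrtDiff₂_le_one (2 * i)]

theorem incCov_self_le (i : ℕ) : incCov i i ≤ 2 := by
  rw [incCov_self]; linarith [sqrtDiff₂_nonneg (2 * i)]

theorem abs_incCov_add (i k : ℕ) :
    |incCov i (i + 1 + k)| = sqrtDiff₂ (2 * i + 1 + k) + sqrtDiff₂ k := by
  rw [incCov_add, ← neg_add', abs_neg,
    abs_of_nonneg (add_nonneg (sqrtDiff₂_nonneg _) (sqrtDiff₂_nonneg _))]

theorem sum_abs_incCov_range_le (i : ℕ) : ∑ j ∈ Finset.range i, |incCov i j| ≤ 2 := by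
  -- With i = j + 1 + k, the indices 2j + 1 + k and k become i + j and i − 1 − j; each runs over
  -- consecutive integers.
  have h : ∀ j ∈ Finset.range i, |incCov i j| = sqrtDiff₂ (i + j) + sqrtDiff₂ (0 + (i - 1 - j)) := by
    intro j hj
    obtain ⟨k, rfl⟩ := Nat.exists_eq_add_of_le (Nat.succ_le_of_lt (Finset.mem_range.1 hj))
    rw [incCov_comm, Nat.succ_eq_add_one, abs_incCov_add]
    congr 2 <;> omega
  rw [Finset.sum_congr rfl h, Finset.sum_add_distrib,
    Finset.sum_range_reflect (fun k => sqrtDiff₂ (0 + k)) i]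
  linarith [sum_sqrtDiff₂_add_le_one i i, sum_sqrtDiff₂_add_le_one 0 i]

/-- The row splits into j < i, j = i and j > i, each contributing at most 2. -/
theorem sum_abs_incCov_le (n : ℕ) (i : Fin n) : ∑ j : Fin n, |incCov i j| ≤ 6 := by
  obtain ⟨i, hi⟩ := i
  obtain ⟨m, rfl⟩ := Nat.exists_eq_add_of_le (Nat.succ_le_of_lt hi)
  rw [Fin.sum_univ_eq_sum_range (fun j => |incCov i j|)]
  have h : ∀ k ∈ Finset.range m, |incCov i (i + 1 + k)| =
      sqrtDiff₂ (2 * i + 1 + k) + sqrtDiff₂ (0 + k) := fun k _ => by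
    rw [abs_incCov_add, zero_add]
  rw [Finset.sum_range_add, Nat.succ_eq_add_one, Finset.sum_range_succ,
    Finset.sum_congr rfl h, Finset.sum_add_distrib, abs_of_nonneg (incCov_self_nonneg i)]
  linarith [sum_sqrtDiff₂_add_le_one (2 * i + 1) m, sum_sqrtDiff₂_add_le_one 0 m,
    incCov_self_le i, sum_abs_incCov_range_le i]

/-- With δ = `sqrtDiff₂ (2 * i)`, (2 − δ)² − 4 = −δ(4 − δ), and the δ sum to at most 1. -/
theorem abs_sum_incCov_self_sq_sub_le (n : ℕ) :
    |∑ i ∈ Finset.range n, incCov i i ^ 2 - 4 * n| ≤ 4 := by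
  have h : ∑ i ∈ Finset.range n, incCov i i ^ 2 - 4 * n =
      -∑ i ∈ Finset.range n, sqrtDiff₂ (2 * i) * (4 - sqrtDiff₂ (2 * i)) := by
    rw [← Finset.sum_neg_distrib, sub_eq_iff_eq_add, show (4 : ℝ) * n = ∑ i ∈ Finset.range n, 4 by
      simp [mul_comm], ← Finset.sum_add_distrib]
    exact Finset.sum_congr rfl fun i _ => by rw [incCov_self]; ring
  rw [h, abs_neg, abs_of_nonneg]
  · have : ∑ i ∈ Finset.range n, sqrtDiff₂ (2 * i) * (4 - sqrtDiff₂ (2 * i)) ≤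
        ∑ i ∈ Finset.range n, 4 * sqrtDiff₂ (2 * i) :=
      Finset.sum_le_sum fun i _ => by nlinarith [sqrtDiff₂_nonneg (2 * i)]
    rw [← Finset.mul_sum] at this
    linarith [sum_sqrtDiff₂_two_mul_le_one n]
  · exact Finset.sum_nonneg fun i _ => mul_nonneg (sqrtDiff₂_nonneg _)
      (by linarith [sqrtDiff₂_le_one (2 * i)])

/-! ### Rescaling to the grid i/N. -/

/-- The constant in the covariance of the mild solution in time. -/
def covConst (θ : ℝ) : ℝ := 1 / √(2 * Real.pi * θ)

theorem integral_mildIntegrand_grid {θ : ℝ} (hθ : 0 < θ) (x : ℝ) (N i j : ℕ)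
    (h : ∀ t, MemLp (mildIntegrand θ t x) 2 spaceTime) :
    ∫ z, mildIntegrand θ ((i : ℝ≥0) / N) x z * mildIntegrand θ ((j : ℝ≥0) / N) x z ∂spaceTime =
      covConst θ / √N * gridCov i j := by
  rw [integral_mildIntegrand_mul hθ _ _ x (h _) (h _)]
  push_cast
  rw [← add_div, ← sub_div, abs_div, abs_of_nonneg (N.cast_nonneg (α := ℝ)),
    Real.sqrt_div (by positivity), Real.sqrt_div (abs_nonneg _)]
  unfold covConst gridCov
  ring

/-- The integrand whose Wiener integral is the increment of the solution over a grid cell. -/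
def incIntegrand (θ x : ℝ) (N i : ℕ) (z : ℝ × ℝ) : ℝ :=
  mildIntegrand θ (((i + 1 : ℕ) : ℝ≥0) / N) x z - mildIntegrand θ ((i : ℝ≥0) / N) x z

theorem integral_incIntegrand_mul {θ : ℝ} (hθ : 0 < θ) (x : ℝ) (N i j : ℕ)
    (h : ∀ t, MemLp (mildIntegrand θ t x) 2 spaceTime) :
    ∫ z, incIntegrand θ x N i z * incIntegrand θ x N j z ∂spaceTime =
      covConst θ / √N * incCov i j := by
  have e : ∀ z, incIntegrand θ x N i z * incIntegrand θ x N j z =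
      mildIntegrand θ (((i + 1 : ℕ) : ℝ≥0) / N) x z * mildIntegrand θ (((j + 1 : ℕ) : ℝ≥0) / N) x z
      - mildIntegrand θ (((i + 1 : ℕ) : ℝ≥0) / N) x z * mildIntegrand θ ((j : ℝ≥0) / N) x z
      - mildIntegrand θ ((i : ℝ≥0) / N) x z * mildIntegrand θ (((j + 1 : ℕ) : ℝ≥0) / N) x z
      + mildIntegrand θ ((i : ℝ≥0) / N) x z * mildIntegrand θ ((j : ℝ≥0) / N) x z := by
    intro z; unfold incIntegrand; ring
  have hi : ∀ s t, Integrable (fun z => mildIntegrand θ s x z * mildIntegrand θ t x z) spaceTime :=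
    fun s t => (h s).integrable_mul (h t)
  simp_rw [e]
  rw [integral_add, integral_sub, integral_sub,
    integral_mildIntegrand_grid hθ x N _ _ h, integral_mildIntegrand_grid hθ x N _ _ h,
    integral_mildIntegrand_grid hθ x N _ _ h, integral_mildIntegrand_grid hθ x N _ _ h]
  · unfold incCov
    ring
  · exact hi _ _
  · exact hi _ _
  · exact (hi _ _).sub (hi _ _)
  · exact hi _ _
  · exact ((hi _ _).sub (hi _ _)).sub (hi _ _)
  · exact hi _ _

/-! ### Mean, fluctuations and limit of the quartic variation. -/

section

theorem covConst_pos {θ : ℝ} (hθ : 0 < θ) : 0 < covConst θ := by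
  have := Real.pi_pos
  unfold covConst; positivity

theorem twelve_mul_covConst_sq {θ : ℝ} (hθ : 0 < θ) :
    12 * covConst θ ^ 2 = 6 / (Real.pi * θ) := by
  have := Real.pi_pos
  rw [covConst, div_pow, Real.sq_sqrt (by positivity)]
  field_simp
  norm_num

/-- The expectation of the quartic variation. -/
def meanQuartic (θ : ℝ) (N : ℕ) : ℝ :=
  ∑ i : Fin N, 3 * (covConst θ / √N * incCov i i) ^ 2

theorem abs_meanQuartic_sub_le {θ : ℝ} (hθ : 0 < θ) {N : ℕ} (hN : 1 ≤ N) :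
    |meanQuartic θ N - 6 / (Real.pi * θ)| ≤ 12 * covConst θ ^ 2 / N := by
  have hN' : (0 : ℝ) < N := by exact_mod_cast hN
  have h1 : meanQuartic θ N - 6 / (Real.pi * θ) =
      3 * covConst θ ^ 2 / N * (∑ i ∈ Finset.range N, incCov i i ^ 2 - 4 * N) := by
    rw [← twelve_mul_covConst_sq hθ, meanQuartic,
      Fin.sum_univ_eq_sum_range (fun i => 3 * (covConst θ / √N * incCov i i) ^ 2) N]
    simp_rw [mul_pow, div_pow, Real.sq_sqrt hN'.le]
    rw [mul_sub, Finset.mul_sum]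
    congr 1
    · exact Finset.sum_congr rfl fun i _ => by ring
    · field_simp; ring
  rw [h1, abs_mul, abs_of_nonneg (by positivity)]
  calc _ ≤ 3 * covConst θ ^ 2 / N * 4 :=
        mul_le_mul_of_nonneg_left (abs_sum_incCov_self_sq_sub_le N) (by positivity)
    _ = _ := by ring

theorem tendsto_meanQuartic {θ : ℝ} (hθ : 0 < θ) :
    Tendsto (meanQuartic θ) atTop (𝓝 (6 / (Real.pi * θ))) := by
  rw [tendsto_iff_norm_sub_tendsto_zero]
  refine squeeze_zero' (Eventually.of_forall fun _ => norm_nonneg _) ?_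
    (tendsto_const_div_atTop_nhds_zero_nat (12 * covConst θ ^ 2))
  filter_upwards [eventually_ge_atTop 1] with N hN
  exact abs_meanQuartic_sub_le hθ hN

/-- The constant in the fourth moment bound for the centered quartic variation. -/
def fourthMomentConst (θ : ℝ) : ℝ :=
  (Real.pi / 2) ^ 4 * (768 * 6 ^ 2 * 2 ^ 6 * ∫ x, x ^ 12 ∂gaussianReal 0 1) * covConst θ ^ 8

theorem fourthMomentConst_nonneg (θ : ℝ) : 0 ≤ fourthMomentConst θ := by
  have : 0 ≤ ∫ x, x ^ 12 ∂gaussianReal 0 1 := integral_nonneg fun x => by positivity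
  have := Real.pi_pos
  unfold fourthMomentConst
  refine mul_nonneg (by positivity) ?_
  rw [show (8 : ℕ) = 2 * 4 by norm_num, pow_mul]
  positivity

theorem quarticVariation_eq {Ω : Type*} {u : ℝ≥0 → ℝ → Ω → ℝ} (N : ℕ) (x : ℝ) (ω : Ω) :
    quarticVariation u N x ω = ∑ i : Fin N,
      (u ((((i : ℕ) + 1 : ℕ) : ℝ≥0) / N) x ω - u (((i : ℕ) : ℝ≥0) / N) x ω) ^ 4 :=
  (Fin.sum_univ_eq_sum_range (fun i =>
    (u (((i + 1 : ℕ) : ℝ≥0) / N) x ω - u ((i : ℝ≥0) / N) x ω) ^ 4) N).symm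

variable {Ω : Type*} [MeasurableSpace Ω] {P : Measure Ω} {W : ℝ≥0 → BoundedBorel → Ω → ℝ}
  {u : ℝ≥0 → ℝ → Ω → ℝ} {θ : ℝ}

namespace IsMildSolution

theorem isCenteredGaussian_increments (hθ : 0 < θ) (hW : IsSpaceTimeWhiteNoise W P)
    (hu : IsMildSolution θ W P u) (x : ℝ) (N : ℕ) :
    IsCenteredGaussian (P.map fun ω (i : Fin N) =>
      u ((((i : ℕ) + 1 : ℕ) : ℝ≥0) / N) x ω - u (((i : ℕ) : ℝ≥0) / N) x ω)
      fun i j => covConst θ / √N * incCov i j := by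
  have h := IsWienerIntegral.isCenteredGaussian hW (ι := Fin N)
    (f := fun i => incIntegrand θ x N i)
    (X := fun i ω => u ((((i : ℕ) + 1 : ℕ) : ℝ≥0) / N) x ω - u (((i : ℕ) : ℝ≥0) / N) x ω)
    fun i => (hu _ x).sub hW (hu _ x)
  simpa only [integral_incIntegrand_mul hθ x N _ _ fun t => (hu t x).1] using h

theorem aemeasurable_increments (hu : IsMildSolution θ W P u) (x : ℝ) (N : ℕ) :
    AEMeasurable (fun ω (i : Fin N) =>
      u ((((i : ℕ) + 1 : ℕ) : ℝ≥0) / N) x ω - u (((i : ℕ) : ℝ≥0) / N) x ω) P :=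
  aemeasurable_pi_lambda _ fun _ => ((hu _ x).2.1.1.sub (hu _ x).2.1.1).aemeasurable

theorem memLp_quarticVariation (hθ : 0 < θ) (hW : IsSpaceTimeWhiteNoise W P)
    (hu : IsMildSolution θ W P u) (x : ℝ) (N : ℕ) {p : ℝ≥0∞} (hp : p ≠ ∞) :
    MemLp (quarticVariation u N x) p P := by
  have h := ((hu.isCenteredGaussian_increments hθ hW x N).memLp_sum_pow_four hp).comp_of_map
    (hu.aemeasurable_increments x N)
  exact h.ae_eq (ae_of_all _ fun ω => (quarticVariation_eq N x ω).symm)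

theorem lintegral_quarticVariation_sub_pow_four_le (hθ : 0 < θ) (hW : IsSpaceTimeWhiteNoise W P)
    (hu : IsMildSolution θ W P u) (x : ℝ) {N : ℕ} (hN : 1 ≤ N) :
    ∫⁻ ω, ENNReal.ofReal ((quarticVariation u N x ω - meanQuartic θ N) ^ 4) ∂P ≤
      ENNReal.ofReal (fourthMomentConst θ / N ^ 2) := by
  have hN' : (0 : ℝ) < N := by exact_mod_cast hN
  have hc := covConst_pos hθ
  have hκ : 0 ≤ covConst θ / √N := by positivity
  -- Here M = 6κ and s = 2κ with κ = `covConst θ / √N`; then M² s⁶ is of order κ⁸, i.e. N⁻⁴, against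
  -- the factor N² from the dimension.
  have h := (hu.isCenteredGaussian_increments hθ hW x N).lintegral_quartic_le
    (fun i j => by rw [incCov_comm]) (M := covConst θ / √N * 6) (s := covConst θ / √N * 2)
    (fun i => by
      simp_rw [abs_mul, abs_of_nonneg hκ]
      rw [← Finset.mul_sum]
      exact mul_le_mul_of_nonneg_left (sum_abs_incCov_le N i) hκ)
    (fun i => mul_le_mul_of_nonneg_left (incCov_self_le i) hκ)
  rw [lintegral_map' (by fun_prop : Measurable _).aemeasurable
    (hu.aemeasurable_increments x N)] at h
  simp_rw [quarticVariation_eq]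
  refine h.trans (le_of_eq (congrArg ENNReal.ofReal ?_))
  have hs : √(N : ℝ) ^ 8 = (N : ℝ) ^ 4 := by
    rw [show (8 : ℕ) = 2 * 4 by norm_num, pow_mul, Real.sq_sqrt hN'.le]
  have hs0 : √(N : ℝ) ≠ 0 := by positivity
  have e : (covConst θ / √N * 6) ^ 2 * (covConst θ / √N * 2) ^ 6 =
      6 ^ 2 * 2 ^ 6 * covConst θ ^ 8 / (N : ℝ) ^ 4 := by
    rw [← hs]; field_simp
  calc _ = (Real.pi / 2) ^ 4 * 768 * (N : ℝ) ^ 2 * (∫ x, x ^ 12 ∂gaussianReal 0 1) *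
        ((covConst θ / √N * 6) ^ 2 * (covConst θ / √N * 2) ^ 6) := by
        rw [Fintype.card_fin]; ring
    _ = _ := by
        rw [e, fourthMomentConst]; field_simp

theorem integral_quarticVariation_sub_sq_le [IsProbabilityMeasure P] (hθ : 0 < θ)
    (hW : IsSpaceTimeWhiteNoise W P) (hu : IsMildSolution θ W P u) (x : ℝ) {N : ℕ} (hN : 1 ≤ N) :
    ∫ ω, (quarticVariation u N x ω - meanQuartic θ N) ^ 2 ∂P ≤ √(fourthMomentConst θ) / N := by
  have hN' : (0 : ℝ) < N := by exact_mod_cast hN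
  have hL : ∀ {p : ℝ≥0∞}, p ≠ ∞ →
      MemLp (fun ω => quarticVariation u N x ω - meanQuartic θ N) p P := fun hp =>
    (hu.memLp_quarticVariation hθ hW x N hp).sub (memLp_const _)
  have h2 := (hL ENNReal.ofNat_ne_top).integrable_sq
  have h4 : Integrable (fun ω => (quarticVariation u N x ω - meanQuartic θ N) ^ 4) P :=
    (memLp_pow_of_memLp_mul (p := 1) (n := 4) (by norm_num) (hL (by norm_num))).integrable le_rfl
  have hle := hu.lintegral_quarticVariation_sub_pow_four_le hθ hW x hN
  rw [← ofReal_integral_eq_lintegral_ofReal h4 (ae_of_all _ fun ω => by positivity),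
    ENNReal.ofReal_le_ofReal_iff
      (div_nonneg (fourthMomentConst_nonneg θ) (by positivity))] at hle
  -- Jensen bounds the second moment by the square root of the fourth.
  have hJ : (∫ ω, (quarticVariation u N x ω - meanQuartic θ N) ^ 2 ∂P) ^ 2 ≤
      ∫ ω, ((quarticVariation u N x ω - meanQuartic θ N) ^ 2) ^ 2 ∂P :=
    (Even.convexOn_pow (by decide : Even 2)).map_integral_le (by fun_prop) isClosed_univ
      (ae_of_all _ fun _ => Set.mem_univ _) h2 (by simpa [Function.comp_def, ← pow_mul] using h4)
  simp_rw [← pow_mul] at hJ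
  have := Real.le_sqrt_of_sq_le (hJ.trans hle)
  rwa [Real.sqrt_div (fourthMomentConst_nonneg θ), Real.sqrt_sq hN'.le] at this

theorem integral_abs_quarticVariation_sub_sq_le [IsProbabilityMeasure P] (hθ : 0 < θ)
    (hW : IsSpaceTimeWhiteNoise W P) (hu : IsMildSolution θ W P u) (x : ℝ) {N : ℕ} (hN : 1 ≤ N) :
    ∫ ω, |quarticVariation u N x ω - 6 / (Real.pi * θ)| ^ 2 ∂P ≤
      (2 * √(fourthMomentConst θ) + 2 * (12 * covConst θ ^ 2) ^ 2) * (1 / N) := by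
  have hN' : (1 : ℝ) ≤ N := by exact_mod_cast hN
  have h2 : ∀ c : ℝ, Integrable (fun ω => (quarticVariation u N x ω - c) ^ 2) P := fun c =>
    ((hu.memLp_quarticVariation hθ hW x N ENNReal.ofNat_ne_top).sub (memLp_const c)).integrable_sq
  -- The squared bias is O(1/N²), weakened to 1/N to match the variance.
  have hb : (meanQuartic θ N - 6 / (Real.pi * θ)) ^ 2 ≤ (12 * covConst θ ^ 2) ^ 2 * (1 / N) := by
    rw [← sq_abs]
    refine (pow_le_pow_left₀ (abs_nonneg _) (abs_meanQuartic_sub_le hθ hN) 2).trans ?_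
    rw [div_pow, div_eq_mul_one_div]
    refine mul_le_mul_of_nonneg_left ?_ (by positivity)
    exact one_div_le_one_div_of_le (by positivity) (by nlinarith)
  simp_rw [sq_abs]
  calc ∫ ω, (quarticVariation u N x ω - 6 / (Real.pi * θ)) ^ 2 ∂P
      ≤ ∫ ω, (2 * (quarticVariation u N x ω - meanQuartic θ N) ^ 2 +
          2 * (meanQuartic θ N - 6 / (Real.pi * θ)) ^ 2) ∂P := by
        refine integral_mono (h2 _) (((h2 _).const_mul 2).add (integrable_const _)) fun ω => ?_
        simp only
        nlinarith [sq_nonneg ((quarticVariation u N x ω - meanQuartic θ N) -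
          (meanQuartic θ N - 6 / (Real.pi * θ)))]
    _ = 2 * ∫ ω, (quarticVariation u N x ω - meanQuartic θ N) ^ 2 ∂P +
          2 * (meanQuartic θ N - 6 / (Real.pi * θ)) ^ 2 := by
        rw [integral_add ((h2 _).const_mul 2) (integrable_const _), integral_const_mul]
        simp
    _ ≤ 2 * (√(fourthMomentConst θ) / N) + 2 * ((12 * covConst θ ^ 2) ^ 2 * (1 / N)) := by
        gcongr
        exact hu.integral_quarticVariation_sub_sq_le hθ hW x hN
    _ = _ := by ring

/-- By Tonelli the series of fourth powers of the centered variables has finite expectation, so it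
converges almost surely and its terms tend to 0. The index is shifted because the moment bound needs
N ≥ 1. -/
theorem ae_tendsto_quarticVariation (hθ : 0 < θ)
    (hW : IsSpaceTimeWhiteNoise W P) (hu : IsMildSolution θ W P u) (x : ℝ) :
    ∀ᵐ ω ∂P, Tendsto (fun N : ℕ => quarticVariation u N x ω) atTop (𝓝 (6 / (Real.pi * θ))) := by
  have hm : ∀ N : ℕ, AEMeasurable (fun ω => ENNReal.ofReal
      ((quarticVariation u (N + 1) x ω - meanQuartic θ (N + 1)) ^ 4)) P := fun N =>
    (((hu.memLp_quarticVariation hθ hW x (N + 1) ENNReal.one_ne_top).1.aemeasurable.sub_const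
      _).pow_const 4).ennreal_ofReal
  have hsum : Summable fun N : ℕ => fourthMomentConst θ / ((N + 1 : ℕ) : ℝ) ^ 2 :=
    ((summable_nat_add_iff 1).2 (Real.summable_one_div_nat_pow.2 one_lt_two)).mul_left
      (fourthMomentConst θ) |>.congr fun N => by ring
  have hfin : ∫⁻ ω, ∑' N : ℕ, ENNReal.ofReal
      ((quarticVariation u (N + 1) x ω - meanQuartic θ (N + 1)) ^ 4) ∂P ≠ ∞ := by
    rw [lintegral_tsum hm]
    refine ne_top_of_le_ne_top hsum.tsum_ofReal_ne_top (ENNReal.tsum_le_tsum fun N => ?_)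
    exact hu.lintegral_quarticVariation_sub_pow_four_le hθ hW x (Nat.le_add_left 1 N)
  filter_upwards [ae_lt_top' (AEMeasurable.tsum hm) hfin] with ω hω
  rw [← tendsto_add_atTop_iff_nat 1]
  have h0 := (ENNReal.tendsto_toReal ENNReal.zero_ne_top).comp
    (ENNReal.tendsto_atTop_zero_of_tsum_ne_top hω.ne)
  have h4 : Tendsto (fun N : ℕ => (quarticVariation u (N + 1) x ω - meanQuartic θ (N + 1)) ^ 4)
      atTop (𝓝 0) := by
    refine h0.congr fun N => ?_
    rw [Function.comp_apply, ENNReal.toReal_ofReal (by positivity)]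
  have h1 : Tendsto (fun N : ℕ => quarticVariation u (N + 1) x ω - meanQuartic θ (N + 1))
      atTop (𝓝 0) := by
    rw [tendsto_zero_iff_abs_tendsto_zero]
    -- The fourth root is taken as two square roots.
    have := (Real.continuous_sqrt.tendsto _).comp ((Real.continuous_sqrt.tendsto _).comp h4)
    simp only [Real.sqrt_zero] at this
    refine this.congr fun N => ?_
    simp only [Function.comp_apply]
    rw [show ∀ y : ℝ, y ^ 4 = (y ^ 2) ^ 2 from fun y => by ring, Real.sqrt_sq (sq_nonneg _),
      Real.sqrt_sq_eq_abs]
  simpa using h1.add ((tendsto_add_atTop_iff_nat 1).2 (tendsto_meanQuartic hθ))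

theorem tendsto_eLpNorm_quarticVariation [IsProbabilityMeasure P] (hθ : 0 < θ)
    (hW : IsSpaceTimeWhiteNoise W P) (hu : IsMildSolution θ W P u) (x : ℝ) :
    Tendsto (fun N : ℕ => eLpNorm (fun ω => quarticVariation u N x ω - 6 / (Real.pi * θ)) 2 P)
      atTop (𝓝 0) := by
  have hL : ∀ N, MemLp (fun ω => quarticVariation u N x ω - 6 / (Real.pi * θ)) 2 P := fun N =>
    (hu.memLp_quarticVariation hθ hW x N ENNReal.ofNat_ne_top).sub (memLp_const _)
  have hlim := (tendsto_one_div_atTop_nhds_zero_nat (𝕜 := ℝ)).const_mul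
    (2 * √(fourthMomentConst θ) + 2 * (12 * covConst θ ^ 2) ^ 2)
  have hsq : Tendsto (fun N : ℕ =>
      (eLpNorm (fun ω => quarticVariation u N x ω - 6 / (Real.pi * θ)) 2 P).toReal ^ 2)
      atTop (𝓝 0) := by
    refine squeeze_zero' (Eventually.of_forall fun _ => sq_nonneg _) ?_
      (by simpa using hlim)
    filter_upwards [eventually_ge_atTop 1] with N hN
    rw [← integral_sq_eq_toReal_eLpNorm_sq (hL N)]
    have := hu.integral_abs_quarticVariation_sub_sq_le hθ hW x hN
    simpa only [sq_abs, one_div] using this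
  rw [← ENNReal.tendsto_toReal_iff (fun N => (hL N).2.ne) ENNReal.zero_ne_top, ENNReal.toReal_zero]
  have := (Real.continuous_sqrt.tendsto _).comp hsq
  rw [Real.sqrt_zero] at this
  exact this.congr fun N => Real.sqrt_sq ENNReal.toReal_nonneg

end IsMildSolution

end

end StochHeat

end

theorem proposition3p1 (θ : ℝ) (hθ : 0 < θ) :
    ∃ C : ℝ, 0 < C ∧ ∃ N₀ : ℕ, 1 ≤ N₀ ∧
      ∀ (Ω : Type*) [MeasurableSpace Ω] (P : Measure Ω) [IsProbabilityMeasure P]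
        (W : ℝ≥0 → StochHeat.BoundedBorel → Ω → ℝ) (_ : StochHeat.IsSpaceTimeWhiteNoise W P)
        (u₀ : ℝ≥0 → ℝ → Ω → ℝ) (_ : StochHeat.IsMildSolution θ W P u₀) (x : ℝ),
        -- almost sure convergence
        (∀ᵐ ω ∂P, Tendsto (fun N : ℕ => StochHeat.quarticVariation u₀ N x ω) atTop
          (𝓝 (6 / (Real.pi * θ)))) ∧
        -- convergence in `L²(P)`
        ((∀ N : ℕ, MemLp (StochHeat.quarticVariation u₀ N x) 2 P) ∧
          Tendsto (fun N : ℕ =>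
            eLpNorm (fun ω => StochHeat.quarticVariation u₀ N x ω - 6 / (Real.pi * θ)) 2 P)
            atTop (𝓝 0)) ∧
        -- rate of convergence in mean square
        (∀ N : ℕ, N₀ ≤ N →
          ∫ ω, |StochHeat.quarticVariation u₀ N x ω - 6 / (Real.pi * θ)| ^ 2 ∂P ≤ C * (1 / N)) := by
  have hC := StochHeat.covConst_pos hθ
  -- Variance and squared bias each enter with factor 2, from (a + b)² ≤ 2a² + 2b². The bias term
  -- makes the constant positive, and N₀ = 1 works.
  refine ⟨2 * √(StochHeat.fourthMomentConst θ) + 2 * (12 * StochHeat.covConst θ ^ 2) ^ 2,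
    by positivity, 1, le_rfl, fun Ω _ P _ W hW u₀ hu x => ⟨?_, ⟨?_, ?_⟩, ?_⟩⟩
  · exact hu.ae_tendsto_quarticVariation hθ hW x
  · exact fun N => hu.memLp_quarticVariation hθ hW x N ENNReal.ofNat_ne_top
  · exact hu.tendsto_eLpNorm_quarticVariation hθ hW x
  · exact fun N hN => hu.integral_abs_quarticVariation_sub_sq_le hθ hW x hN
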